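/- All graphs are finite and simple. For a graph $H$, let $\rho(H)$ denote its spectral radius, that is, the largest eigenvalue of its adjacency matrix. For integers $2\le s\le t$, let $K_{s,t}$ be the complete bipartite graph with parts of orders $s$ and $t$, let $K^-_{s,t}$ be the graph obtained from $K_{s,t}$ by deleting one edge, and let $K^+_{s,t}$ be the graph obtained from $K_{s,t}$ by adding a new vertex $x$ and a new edge $xy$, where $y$ is a vertex in the part of order $s$. Let $G$ be a bipartite graph with $e$ edges and without isolated vertices. Suppose that $G$ is not isomorphic to $K_{p,q}$ for any integers $1\le p\le q$ with $e=pq$, nor to $K^-_{p',q'}$ for any integers $2\le p'\le q'$ with $e=p'q'-1$, nor to $K^+_{p'',q''}$ for any integers $2\le p''\le q''$ with $e=p''q''+1$. Let $s,t$ be integers with $2\le s\le t$. 1. If $e=st+1$, then $\rho(G)<\rho(K^+_{s,t})$. 2. If $e=st-1$, then $\rho(G)<\rho(K^-_{s,t})$. -/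

import Mathlib

open Classical in
/-- The spectral radius of a finite graph in the sense of spectral graph theory: the largest (real)
eigenvalue of its adjacency matrix. (The adjacency matrix is real symmetric, so as soon as there is
at least one vertex the set of eigenvalues is finite and nonempty and the supremum is a maximum.) -/
noncomputable def adjSpectralRadius {V : Type*} [Fintype V] (G : SimpleGraph V) : ℝ :=
  sSup {μ : ℝ | Module.End.HasEigenvalue (G.adjMatrix ℝ).mulVecLin μ}

/-- The bipartite graph on the disjoint union `α ⊕ β` whose edges are the pairs `{a, b}`
with `a : α`, `b : β` and `r a b`. -/
def bipartiteOfRel {α β : Type*} (r : α → β → Prop) : SimpleGraph (α ⊕ β) where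
  Adj
    | Sum.inl a, Sum.inr b => r a b
    | Sum.inr b, Sum.inl a => r a b
    | _, _ => False
  symm := ⟨by rintro (a | b) (a' | b') h <;> exact h⟩
  loopless := ⟨by rintro (a | b) h <;> exact h⟩

/-- `K⁻_{s,t}`: the complete bipartite graph `K_{s,t}` with one edge deleted, namely the edge
joining the vertex `0` of the part `Fin s` to the vertex `0` of the part `Fin t`. -/
def completeBipartiteMinus (s t : ℕ) : SimpleGraph (Fin s ⊕ Fin t) :=
  bipartiteOfRel fun i j => ¬ (i.val = 0 ∧ j.val = 0)

/-- `K⁺_{s,t}`: the complete bipartite graph `K_{s,t}` with parts `Fin s` and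
`{0, …, t - 1} ⊆ Fin (t + 1)`, together with a new vertex, the last element `t` of `Fin (t + 1)`,
which is joined only to the vertex `0` of the part `Fin s` of order `s`. -/
def completeBipartitePlus (s t : ℕ) : SimpleGraph (Fin s ⊕ Fin (t + 1)) :=
  bipartiteOfRel fun i j => j.val < t ∨ i.val = 0

/-! Let B be the biadjacency matrix of G and call an ordered pair of edges (i,j), (k,l) bad unless
(i,l) and (k,j) are edges too. The squared Frobenius norm of B Bᵀ counts the pairs that are not bad,
so it equals e² - D with D = `badCount`; hence ρ(G)⁴ ≤ e² - D (`pow_four_add_badCount_le`). K⁺ and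
K⁻ are block graphs (`IsBlock`): an edge is missing exactly when neither end is joined to the whole
other side. For block sizes a, b, c, d, a positive root l of l(e - l) = N = abcd gives an eigenvalue
√l. The larger root is within 1 of e, so the integer gap D ≥ 2N + 1 already makes ρ(G) strictly
smaller (`IsBlock.adjSpectralRadius_lt`). It remains to bound D from below
(`le_badCount_or_isBlock`). If every edge is in a bad pair, D ≥ 2e - 2. Otherwise some edge joins a
full row to a full column, and counting around full rows and columns gives D ≥ 2e - 4 with e ≥ 4,
apart from complete graphs and block graphs with few parameters. Those are K⁻, K⁺, or a complete
bipartite graph with a pendant edge at its larger part; the first two are excluded by hypothesis and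
the last has D large enough. -/

/-- The pairs related by `r`, i.e. the edges of `bipartiteOfRel r`. -/
noncomputable def relEdges {α β : Type*} [Fintype α] [Fintype β] (r : α → β → Prop) :
    Finset (α × β) := by
  classical exact Finset.univ.filter fun p => r p.1 p.2

/-- The edges `q` such that `p`, `q` do not span a complete bipartite graph. -/
noncomputable def badPartners {α β : Type*} [Fintype α] [Fintype β] (r : α → β → Prop)
    (p : α × β) : Finset (α × β) := by
  classical exact (relEdges r).filter fun q => ¬ (r p.1 q.2 ∧ r q.1 p.2)

/-- The number of ordered pairs of edges that do not span a complete bipartite graph; it is twice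
the number of nonsingular `2 × 2` submatrices of the biadjacency matrix. -/
noncomputable def badCount {α β : Type*} [Fintype α] [Fintype β] (r : α → β → Prop) : ℕ :=
  ∑ p ∈ relEdges r, (badPartners r p).card

/-! ### Bad pairs when every edge has a bad partner -/

section Counting

variable {α β : Type*} [Fintype α] [Fintype β] {r : α → β → Prop}

theorem mem_relEdges {p : α × β} : p ∈ relEdges r ↔ r p.1 p.2 := by
  simp [relEdges]

theorem mem_badPartners {p q : α × β} :
    q ∈ badPartners r p ↔ r q.1 q.2 ∧ ¬ (r p.1 q.2 ∧ r q.1 p.2) := by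
  simp [badPartners, mem_relEdges]

theorem card_relEdges_flip (r : α → β → Prop) :
    (relEdges (flip r)).card = (relEdges r).card := by
  refine Finset.card_bij (fun p _ => p.swap) ?_ ?_ ?_
  · rintro ⟨a, b⟩ h; simpa [mem_relEdges, flip] using h
  · rintro ⟨a, b⟩ _ ⟨a', b'⟩ _ h; simpa [and_comm] using h
  · rintro ⟨a, b⟩ h; exact ⟨(b, a), by simpa [mem_relEdges, flip] using h, rfl⟩

theorem card_badPartners_flip (r : α → β → Prop) (p : α × β) :
    (badPartners (flip r) p.swap).card = (badPartners r p).card := by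
  refine Finset.card_bij (fun p _ => p.swap) ?_ ?_ ?_
  · rintro ⟨a, b⟩ h; simp [mem_badPartners, flip] at h ⊢; tauto
  · rintro ⟨a, b⟩ _ ⟨a', b'⟩ _ h; simpa [and_comm] using h
  · rintro ⟨a, b⟩ h
    refine ⟨(b, a), ?_, rfl⟩
    simp [mem_badPartners, flip] at h ⊢; tauto

theorem badCount_flip (r : α → β → Prop) : badCount (flip r) = badCount r := by
  refine Finset.sum_bij (fun p _ => p.swap) ?_ ?_ ?_ ?_
  · rintro ⟨a, b⟩ h; simpa [mem_relEdges, flip] using h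
  · rintro ⟨a, b⟩ _ ⟨a', b'⟩ _ h; simpa [and_comm] using h
  · rintro ⟨a, b⟩ h; exact ⟨(b, a), by simpa [mem_relEdges, flip] using h, rfl⟩
  · rintro ⟨a, b⟩ _; exact card_badPartners_flip r (b, a)

/-- Two edges with many bad partners suffice when every edge has a bad partner. -/
theorem le_badCount_of_two (h1 : ∀ p ∈ relEdges r, 1 ≤ (badPartners r p).card)
    {p q : α × β} (hp : p ∈ relEdges r) (hq : q ∈ relEdges r) (hpq : p ≠ q) :
    (relEdges r).card + (badPartners r p).card + (badPartners r q).card ≤ badCount r + 2 := by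
  classical
  unfold badCount
  rw [← Finset.add_sum_erase _ _ hp,
    ← Finset.add_sum_erase _ _ (Finset.mem_erase.2 ⟨hpq.symm, hq⟩)]
  have h2 : (((relEdges r).erase p).erase q).card ≤
      ∑ x ∈ ((relEdges r).erase p).erase q, (badPartners r x).card := by
    rw [Finset.card_eq_sum_ones]
    exact Finset.sum_le_sum fun x hx =>
      h1 x (Finset.mem_of_mem_erase (Finset.mem_of_mem_erase hx))
  rw [Finset.card_erase_of_mem (Finset.mem_erase.2 ⟨hpq.symm, hq⟩),
    Finset.card_erase_of_mem hp] at h2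
  omega

/-- The number of bad pairs is large if every edge has a bad partner and `(x, y)` is the only one
of some edge `(i, j)` with `r i y`. -/
theorem le_badCount_of_pendant (h1 : ∀ p ∈ relEdges r, 1 ≤ (badPartners r p).card)
    {i x : α} {j y : β} (hxy : r x y) (hiy : r i y) (hxj : ¬ r x j)
    (hall : ∀ q ∈ badPartners r (i, j), q = (x, y)) (hrow : ∀ a, ∃ b, r a b)
    (hcol : ∀ b, ∃ a, r a b) :
    2 * (relEdges r).card ≤ badCount r + 2 := by
  classical
  have hfull : ∀ b, r i b := by
    intro b
    by_contra hb
    obtain ⟨a, ha⟩ := hcol b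
    have := hall (a, b) (mem_badPartners.2 ⟨ha, fun h => hb h.1⟩)
    simp only [Prod.mk.injEq] at this
    exact hb (this.2 ▸ hiy)
  have hj : ∀ a, a ≠ x → r a j := by
    intro a hax
    by_contra hb
    obtain ⟨b, ha⟩ := hrow a
    have := hall (a, b) (mem_badPartners.2 ⟨ha, fun h => hb h.2⟩)
    simp only [Prod.mk.injEq] at this
    exact hax this.1
  have hx : ∀ b, r x b → b = y := by
    intro b hb
    have := hall (x, b) (mem_badPartners.2 ⟨hb, fun h => hxj h.2⟩)
    simpa using this
  obtain ⟨⟨u, v⟩, huv⟩ := Finset.card_pos.1 (h1 (i, y) (mem_relEdges.2 hiy))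
  rw [mem_badPartners] at huv
  have huy : ¬ r u y := fun h => huv.2 ⟨hfull v, h⟩
  have hux : u ≠ x := fun h => huy (h ▸ hxy)
  have huj := hj u hux
  have hjy : j ≠ y := fun h => huy (h ▸ huj)
  have key := le_badCount_of_two h1 (p := (x, y)) (q := (u, j)) (mem_relEdges.2 hxy)
    (mem_relEdges.2 huj) (by simp [hux.symm])
  -- The only neighbour of x is y, so (x, y) is bad with every edge off column y; u misses y, so (u,
  -- j) is bad with every edge in column y. Together they have at least e bad partners, and the
  -- other e - 2 edges have at least one each.
  have hsub : relEdges r ⊆ badPartners r (x, y) ∪ badPartners r (u, j) := by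
    rintro ⟨a, b⟩ hab
    rw [mem_relEdges] at hab
    rw [Finset.mem_union, mem_badPartners, mem_badPartners]
    by_cases hb : b = y
    · right; exact ⟨hab, fun h => huy (hb ▸ h.1)⟩
    · left; exact ⟨hab, fun h => hb (hx b h.1)⟩
  have := (Finset.card_le_card hsub).trans (Finset.card_union_le _ _)
  omega

/-- Without an edge that spans a complete bipartite graph with every other edge, the number of bad
pairs is large. -/
theorem le_badCount_of_forall (hrow : ∀ a, ∃ b, r a b) (hcol : ∀ b, ∃ a, r a b)
    (h1 : ∀ p ∈ relEdges r, 1 ≤ (badPartners r p).card) :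
    2 * (relEdges r).card ≤ badCount r + 2 := by
  classical
  by_cases h2 : ∀ p ∈ relEdges r, 2 ≤ (badPartners r p).card
  · have : (relEdges r).card * 2 ≤ badCount r := by
      unfold badCount
      simpa using Finset.card_nsmul_le_sum _ _ _ h2
    omega
  push Not at h2
  obtain ⟨⟨i, j⟩, hij, hlt⟩ := h2
  have hone : (badPartners r (i, j)).card = 1 := le_antisymm (by omega) (h1 _ hij)
  obtain ⟨⟨x, y⟩, hxy⟩ := Finset.card_eq_one.1 hone
  have hall : ∀ q ∈ badPartners r (i, j), q = (x, y) := by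
    intro q hq; rw [hxy] at hq; simpa using hq
  have hmem : (x, y) ∈ badPartners r (i, j) := by rw [hxy]; simp
  rw [mem_badPartners] at hmem
  rw [mem_relEdges] at hij
  obtain ⟨hr, hn⟩ := hmem
  simp only at hr hn hij
  by_cases hiy : r i y
  · exact le_badCount_of_pendant h1 hr hiy (fun h => hn ⟨hiy, h⟩) hall hrow hcol
  by_cases hxj : r x j
  · have := le_badCount_of_pendant (r := flip r) (i := j) (x := y) (j := i) (y := x)
      (fun p hp => by
        have := card_badPartners_flip r p.swap
        rw [Prod.swap_swap] at this
        rw [this]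
        exact h1 _ (by simpa [mem_relEdges, flip] using hp))
      hr hxj hiy
      (fun q hq => by
        have := hall q.swap (by
          simp [mem_badPartners, flip] at hq ⊢; tauto)
        rw [← Prod.swap_swap q, this]; rfl) hcol hrow
    rwa [card_relEdges_flip, badCount_flip] at this
  -- In the remaining case (x, y) is a component of its own, hence bad with all e - 1 other edges.
  have hxi : x ≠ i := fun h => hxj (h ▸ hij)
  have hx : ∀ b, r x b → b = y := by
    intro b hb
    simpa using hall (x, b) (mem_badPartners.2 ⟨hb, fun h => hxj h.2⟩)
  have hy : ∀ a, r a y → a = x := by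
    intro a ha
    simpa using hall (a, y) (mem_badPartners.2 ⟨ha, fun h => hiy h.1⟩)
  have key := le_badCount_of_two h1 (p := (x, y)) (q := (i, j)) (mem_relEdges.2 hr)
    (mem_relEdges.2 hij) (by simp [hxi])
  have hsub : (relEdges r).erase (x, y) ⊆ badPartners r (x, y) := by
    rintro ⟨a, b⟩ hab
    rw [Finset.mem_erase, mem_relEdges] at hab
    rw [mem_badPartners]
    refine ⟨hab.2, fun h => hab.1 ?_⟩
    rw [hx b h.1, hy a h.2]
  have := Finset.card_le_card hsub
  rw [Finset.card_erase_of_mem (mem_relEdges.2 hr)] at this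
  omega

end Counting

/-! ### Arithmetic of the block sizes -/

/-- After substituting w = bd - z, the difference of the two sides has slope (a - 1)(c - 1) ≥ 0 in
z, so the worst case is z = b. There d = 1 and d ≥ 2 are settled by separate factorizations. -/
theorem block_arith_aux {a b c d z w : ℤ} (ha : 1 ≤ a) (hc : 1 ≤ c) (hd : 1 ≤ d)
    (hdb : d ≤ b) (hzw : z + w = b * d) (hz : b ≤ z) :
    a * c + a * d + b * c + w ≤ a * c * z + a * w + c * w + 2 ∨
      (d = 1 ∧ (a = 1 ∨ b = 1)) := by
  obtain rfl : w = b * d - z := by linarith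
  have hmono : 0 ≤ (a - 1) * (c - 1) * (z - b) :=
    mul_nonneg (mul_nonneg (by linarith) (by linarith)) (by linarith)
  rcases hd.eq_or_lt with rfl | hd2
  · by_cases h : a = 1 ∨ b = 1
    · exact Or.inr ⟨rfl, h⟩
    push Not at h
    have ha2 : 2 ≤ a := by have := h.1; omega
    have hb2 : 2 ≤ b := by have := h.2; omega
    left
    have hu : 0 ≤ (c - 1) * ((a - 1) * (b - 1) - 1) :=
      mul_nonneg (by linarith) (by nlinarith)
    have hv : 0 ≤ (a - 1) * (b - 2) := mul_nonneg (by linarith) (by linarith)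
    nlinarith
  · left
    have h1 : 0 ≤ (a + c - 1) * (b * (d - 1) - d) :=
      mul_nonneg (by linarith) (by nlinarith)
    have h2 : 0 ≤ c * ((a - 1) * (b - 1)) := by
      apply mul_nonneg (by linarith) (mul_nonneg (by linarith) (by linarith))
    have h3 : 0 ≤ (c - 1) * (d - 2) := mul_nonneg (by linarith) (by linarith)
    nlinarith

theorem block_arith {a b c d z w : ℕ} (ha : 1 ≤ a) (hb : 1 ≤ b) (hc : 1 ≤ c) (hd : 1 ≤ d)
    (hzw : z + w = b * d) (hzb : b ≤ z) (hzd : d ≤ z) :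
    a * c + a * d + b * c + w ≤ a * c * z + a * w + c * w + 2 ∨
      (d = 1 ∧ (a = 1 ∨ b = 1)) ∨ (b = 1 ∧ (c = 1 ∨ d = 1)) := by
  rcases le_total d b with h | h
  · have := block_arith_aux (a := a) (b := b) (c := c) (d := d) (z := z) (w := w)
      (mod_cast ha) (mod_cast hc) (mod_cast hd) (mod_cast h) (mod_cast hzw) (mod_cast hzb)
    rcases this with h | h
    · left; exact_mod_cast h
    · right; left; exact_mod_cast h
  · have := block_arith_aux (a := c) (b := d) (c := a) (d := b) (z := z) (w := w)
      (mod_cast hc) (mod_cast ha) (mod_cast hb) (mod_cast h)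
      (by rw [mul_comm (d : ℤ)]; exact_mod_cast hzw)
      (mod_cast hzd)
    rcases this with h | h
    · left; zify; linarith
    · right; right; exact_mod_cast h

/-! ### Bad pairs in the presence of a full row and a full column -/

section Full

open Finset

variable {α β : Type*} [Fintype α] [Fintype β]

open Classical in
/-- The number of elements not related to `x`. -/
noncomputable def nonDegree (r : α → β → Prop) (x : α) : ℕ :=
  #{y | ¬ r x y}

open Classical in
/-- The elements related to everything. -/
noncomputable def fullRows (r : α → β → Prop) : Finset α :=
  {x | ∀ y, r x y}

open Classical in
/-- The related pairs, neither of whose members is related to everything. -/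
noncomputable def innerEdges (r : α → β → Prop) : Finset (α × β) :=
  {p ∈ relEdges r | p.1 ∉ fullRows r ∧ p.2 ∉ fullRows (flip r)}

variable {r : α → β → Prop}

theorem mem_fullRows {x : α} : x ∈ fullRows r ↔ ∀ y, r x y := by simp [fullRows]

theorem mem_fullRows_flip {y : β} : y ∈ fullRows (flip r) ↔ ∀ x, r x y := by
  rw [mem_fullRows]; rfl

theorem mem_innerEdges {p : α × β} : p ∈ innerEdges r ↔
    r p.1 p.2 ∧ p.1 ∉ fullRows r ∧ p.2 ∉ fullRows (flip r) := by
  simp [innerEdges, mem_relEdges]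

theorem one_le_nonDegree {x : α} (hx : x ∉ fullRows r) : 1 ≤ nonDegree r x := by
  classical
  rw [mem_fullRows] at hx
  push Not at hx
  obtain ⟨y, hy⟩ := hx
  exact card_pos.2 ⟨y, by simpa using hy⟩

theorem card_innerEdges_flip (r : α → β → Prop) :
    #(innerEdges (flip r)) = #(innerEdges r) := by
  refine card_bij (fun p _ => p.swap) ?_ ?_ ?_
  · rintro ⟨a, b⟩ h; simp [mem_innerEdges, mem_fullRows, flip] at h ⊢; tauto
  · rintro ⟨a, b⟩ _ ⟨a', b'⟩ _ h; simpa [and_comm] using h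
  · rintro ⟨a, b⟩ h
    refine ⟨(b, a), ?_, rfl⟩
    simp [mem_innerEdges, mem_fullRows, flip] at h ⊢; tauto

theorem sum_nonDegree_flip (r : α → β → Prop) :
    ∑ y, nonDegree (flip r) y = ∑ x, nonDegree r x := by
  classical
  simp only [nonDegree, card_filter]
  rw [sum_comm]
  exact sum_congr rfl fun x _ => sum_congr rfl fun y _ => if_congr Iff.rfl rfl rfl

open Classical in
theorem sum_relEdges_eq (f : α × β → ℕ) :
    ∑ p ∈ relEdges r, f p = ∑ p ∈ fullRows r ×ˢ univ, f p +
      ∑ p ∈ (fullRows r)ᶜ ×ˢ fullRows (flip r), f p + ∑ p ∈ innerEdges r, f p := by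
  rw [← sum_filter_add_sum_filter_not (relEdges r) (fun p => p.1 ∈ fullRows r) f,
    ← sum_filter_add_sum_filter_not ((relEdges r).filter fun p => ¬ p.1 ∈ fullRows r)
      (fun p => p.2 ∈ fullRows (flip r)) f, ← add_assoc]
  congr 1
  · congr 1
    · refine sum_congr ?_ fun _ _ => rfl
      ext ⟨x, y⟩
      simp only [mem_filter, mem_relEdges, mem_product, mem_univ, and_true,
        and_iff_right_iff_imp, mem_fullRows]
      exact fun h => h y
    · refine sum_congr ?_ fun _ _ => rfl
      ext ⟨x, y⟩
      simp only [mem_filter, mem_relEdges, mem_product, mem_compl, mem_fullRows_flip]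
      exact ⟨fun h => ⟨h.1.2, h.2⟩, fun h => ⟨⟨h.2 x, h.1⟩, h.2⟩⟩
  · refine sum_congr ?_ fun _ _ => rfl
    ext ⟨x, y⟩
    simp [mem_innerEdges, mem_relEdges, and_assoc]

theorem card_relEdges_eq : #(relEdges r) = #(fullRows r) * Fintype.card β +
    (Fintype.card α - #(fullRows r)) * #(fullRows (flip r)) + #(innerEdges r) := by
  classical
  have := sum_relEdges_eq (r := r) fun _ => 1
  simpa [card_compl] using this

/-- A non-edge lies in a non-full row and a non-full column, so non-edges and inner edges together
tile that block. -/
theorem sum_nonDegree_add_card_innerEdges : ∑ x, nonDegree r x + #(innerEdges r) =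
    (Fintype.card α - #(fullRows r)) * (Fintype.card β - #(fullRows (flip r))) := by
  classical
  rw [← card_compl, ← card_compl, ← card_product,
    ← card_filter_add_card_filter_not (s := (fullRows r)ᶜ ×ˢ (fullRows (flip r))ᶜ)
      (fun p => ¬ r p.1 p.2)]
  congr 1
  · have : ∑ x, nonDegree r x = #(univ.filter fun p : α × β => ¬ r p.1 p.2) := by
      simp only [nonDegree, card_filter]
      rw [Fintype.sum_prod_type]
    rw [this]
    congr 1
    ext ⟨x, y⟩
    simp only [mem_filter, mem_univ, true_and, mem_product, mem_compl, mem_fullRows]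
    exact ⟨fun h => ⟨⟨fun h' => h (h' y), fun h' => h (h' x)⟩, h⟩, fun h => h.2⟩
  · congr 1
    ext ⟨x, y⟩
    simp [mem_innerEdges, and_comm]

theorem card_compl_fullRows_le_sum_nonDegree :
    Fintype.card α - #(fullRows r) ≤ ∑ x, nonDegree r x := by
  classical
  rw [← card_compl, card_eq_sum_ones]
  calc ∑ x ∈ (fullRows r)ᶜ, 1 ≤ ∑ x ∈ (fullRows r)ᶜ, nonDegree r x :=
        sum_le_sum fun x hx => one_le_nonDegree (mem_compl.1 hx)
    _ ≤ _ := sum_le_sum_of_subset (subset_univ _)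

/-- As row i is full, (i, y) is bad with an edge q exactly when q.1 misses y. Summing over y, each q
contributes the number of non-neighbours of q.1; only edges in full columns and inner edges are
kept. -/
theorem le_sum_card_badPartners {i : α} (hi : i ∈ fullRows r) :
    #(fullRows (flip r)) * ∑ x, nonDegree r x + #(innerEdges r) ≤
      ∑ y, #(badPartners r (i, y)) := by
  classical
  rw [mem_fullRows] at hi
  have h1 : ∑ y, #(badPartners r (i, y)) = ∑ q ∈ relEdges r, nonDegree r q.1 := by
    simp only [nonDegree, card_filter, badPartners, hi, true_and]
    exact sum_comm
  rw [h1]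
  have hdisj : Disjoint (univ ×ˢ fullRows (flip r)) (innerEdges r) := by
    rw [disjoint_left]
    rintro ⟨x, y⟩ h h'
    exact (mem_innerEdges.1 h').2.2 (mem_product.1 h).2
  have hsub : univ ×ˢ fullRows (flip r) ∪ innerEdges r ⊆ relEdges r := by
    rintro ⟨x, y⟩ h
    rw [mem_relEdges]
    rcases mem_union.1 h with h | h
    · exact mem_fullRows_flip.1 (mem_product.1 h).2 x
    · exact (mem_innerEdges.1 h).1
  refine le_trans ?_ (sum_le_sum_of_subset hsub)
  rw [sum_union hdisj, sum_product]
  refine add_le_add ?_ ?_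
  · simp [mul_sum]
  · rw [card_eq_sum_ones]
    exact sum_le_sum fun q hq => one_le_nonDegree (mem_innerEdges.1 hq).2.1

/-- If x misses v and u misses y, then (x, y) is bad with (x', v) for each full row x' and with (u,
y') for each full column y'. -/
theorem le_card_badPartners_of_mem_innerEdges {p : α × β} (hp : p ∈ innerEdges r) :
    #(fullRows r) + #(fullRows (flip r)) ≤ #(badPartners r p) := by
  classical
  obtain ⟨x, y⟩ := p
  obtain ⟨-, hx, hy⟩ := mem_innerEdges.1 hp
  have hx' := hx
  have hy' := hy
  simp only [mem_fullRows, not_forall] at hx' hy'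
  obtain ⟨v, hv⟩ := hx'
  obtain ⟨u, hu⟩ := hy'
  have hdisj : Disjoint (fullRows r ×ˢ {v}) ({u} ×ˢ fullRows (flip r)) := by
    rw [disjoint_left]
    rintro ⟨x', y'⟩ h h'
    rw [mem_product, mem_singleton] at h h'
    exact hu (h'.1 ▸ mem_fullRows.1 h.1 y)
  have hsub : fullRows r ×ˢ {v} ∪ {u} ×ˢ fullRows (flip r) ⊆ badPartners r (x, y) := by
    rintro ⟨x', y'⟩ h
    rw [mem_badPartners]
    rw [mem_union, mem_product, mem_product, mem_singleton, mem_singleton] at h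
    rcases h with ⟨h1, rfl⟩ | ⟨rfl, h2⟩
    · exact ⟨mem_fullRows.1 h1 _, fun h => hv h.1⟩
    · exact ⟨mem_fullRows_flip.1 h2 _, fun h => hu h.2⟩
  have := card_le_card hsub
  rw [card_union_of_disjoint hdisj] at this
  simpa using this

theorem le_badCount_of_full : 2 * (#(fullRows r) * #(fullRows (flip r)) * ∑ x, nonDegree r x +
    #(fullRows r) * #(innerEdges r) + #(fullRows (flip r)) * #(innerEdges r)) ≤ badCount r := by
  classical
  have h1 : #(fullRows r) * (#(fullRows (flip r)) * ∑ x, nonDegree r x + #(innerEdges r)) ≤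
      ∑ p ∈ fullRows r ×ˢ univ, #(badPartners r p) := by
    rw [sum_product, ← smul_eq_mul]
    exact card_nsmul_le_sum _ _ _ fun i hi => le_sum_card_badPartners hi
  have h2 : #(fullRows (flip r)) * (#(fullRows r) * ∑ x, nonDegree r x + #(innerEdges r)) ≤
      ∑ p ∈ (fullRows r)ᶜ ×ˢ fullRows (flip r), #(badPartners r p) := by
    rw [sum_product_right, ← smul_eq_mul]
    refine card_nsmul_le_sum _ _ _ fun j hj => ?_
    have := le_sum_card_badPartners (r := flip r) hj
    rw [sum_nonDegree_flip, card_innerEdges_flip] at this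
    refine this.trans (le_of_eq ?_)
    rw [← sum_add_sum_compl (fullRows r)]
    rw [sum_eq_zero, zero_add]
    · exact sum_congr rfl fun x _ => card_badPartners_flip r (x, j)
    -- An edge joining a full row to a full column has no bad partner, so nothing is lost by
    -- dropping the full rows.
    · intro x hx
      rw [card_eq_zero, eq_empty_iff_forall_notMem]
      rintro ⟨y', x'⟩ h
      rw [mem_badPartners] at h
      exact h.2 ⟨mem_fullRows_flip.1 hj x', mem_fullRows.1 hx y'⟩
  have h3 : #(innerEdges r) * (#(fullRows r) + #(fullRows (flip r))) ≤
      ∑ p ∈ innerEdges r, #(badPartners r p) := by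
    rw [← smul_eq_mul]
    exact card_nsmul_le_sum _ _ _ fun p hp => le_card_badPartners_of_mem_innerEdges hp
  have h4 := sum_relEdges_eq (r := r) fun p => #(badPartners r p)
  rw [← badCount] at h4
  nlinarith

theorem card_fullRows_le (r : α → β → Prop) : #(fullRows r) ≤ Fintype.card α := card_le_univ _

/-- When all but one column are full, the full rows are exactly those related to the remaining
column. -/
theorem rel_iff_of_card_eq_one (hC : Fintype.card β - #(fullRows (flip r)) = 1) (x : α) (y : β) :
    r x y ↔ x ∈ fullRows r ∨ y ∈ fullRows (flip r) := by
  classical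
  refine ⟨fun h => ?_, ?_⟩
  · by_contra! hn
    refine hn.1 (mem_fullRows.2 fun y' => ?_)
    by_cases hy' : y' ∈ fullRows (flip r)
    · exact mem_fullRows_flip.1 hy' x
    · rw [← card_compl, card_eq_one] at hC
      obtain ⟨v, hv⟩ := hC
      have h1 : y ∈ (fullRows (flip r))ᶜ := mem_compl.2 hn.2
      have h2 : y' ∈ (fullRows (flip r))ᶜ := mem_compl.2 hy'
      rw [hv, mem_singleton] at h1 h2
      rwa [h2, ← h1]
  · rintro (h | h)
    · exact mem_fullRows.1 h y
    · exact mem_fullRows_flip.1 h x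

/-- `r` relates `x` and `y` as soon as `x ∈ A` or `y ∈ C`, where `A` and `C` have `a` and `c`
elements and complements with `b` and `d` elements. -/
def IsBlock (r : α → β → Prop) (a b c d : ℕ) : Prop :=
  ∃ (A : Finset α) (C : Finset β), #A = a ∧ Fintype.card α = a + b ∧ #C = c ∧
    Fintype.card β = c + d ∧ ∀ x y, r x y ↔ x ∈ A ∨ y ∈ C

theorem IsBlock.flip {a b c d : ℕ} (h : IsBlock r a b c d) : IsBlock (flip r) c d a b := by
  obtain ⟨A, C, h1, h2, h3, h4, h5⟩ := h
  exact ⟨C, A, h3, h4, h1, h2, fun x y => by rw [or_comm]; exact h5 y x⟩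

theorem IsBlock.card_relEdges {a b c d : ℕ} (h : IsBlock r a b c d) :
    #(relEdges r) = a * c + a * d + b * c := by
  classical
  obtain ⟨A, C, h1, h2, h3, h4, h5⟩ := h
  have : relEdges r = A ×ˢ univ ∪ Aᶜ ×ˢ C := by
    ext ⟨x, y⟩
    simp only [mem_relEdges, h5, mem_union, mem_product, mem_univ, mem_compl]
    tauto
  rw [this, card_union_of_disjoint, card_product, card_product, card_compl, h1, h3, h2, card_univ,
    h4, Nat.add_sub_cancel_left]
  · ring
  · rw [disjoint_left]
    rintro ⟨x, y⟩ h h'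
    exact (mem_compl.1 (mem_product.1 h').1) (mem_product.1 h).1

/-- A lower bound for the number of bad pairs, outside a short list of exceptions. -/
theorem le_badCount_or_isBlock (hrow : ∀ a, ∃ b, r a b) (hcol : ∀ b, ∃ a, r a b) :
    2 * #(relEdges r) ≤ badCount r + 2 ∨
    (2 * #(relEdges r) ≤ badCount r + 4 ∧ 4 ≤ #(relEdges r)) ∨
    (∀ x y, r x y) ∨
    ∃ a b c d, 1 ≤ a ∧ 1 ≤ b ∧ 1 ≤ c ∧ 1 ≤ d ∧ IsBlock r a b c d ∧
      2 * (a * b * c * d) ≤ badCount r ∧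
      ((d = 1 ∧ (a = 1 ∨ b = 1)) ∨ (b = 1 ∧ (c = 1 ∨ d = 1))) := by
  classical
  by_cases h0 : ∀ p ∈ relEdges r, 1 ≤ #(badPartners r p)
  · exact Or.inl (le_badCount_of_forall hrow hcol h0)
  right
  by_cases hall : ∀ x y, r x y
  · exact Or.inr (Or.inl hall)
  push Not at h0
  obtain ⟨⟨i, j⟩, hij, h0⟩ := h0
  have h0' : badPartners r (i, j) = ∅ := card_eq_zero.1 (by omega)
  -- Without isolated vertices, a column missed by i would contain an edge, and that edge would be a
  -- bad partner of (i, j).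
  have hi : i ∈ fullRows r := mem_fullRows.2 fun y => by
    by_contra hy
    obtain ⟨x, hx⟩ := hcol y
    have : (x, y) ∈ badPartners r (i, j) := mem_badPartners.2 ⟨hx, fun h => hy h.1⟩
    simp [h0'] at this
  have hj : j ∈ fullRows (flip r) := mem_fullRows_flip.2 fun x => by
    by_contra hx
    obtain ⟨y, hy⟩ := hrow x
    have : (x, y) ∈ badPartners r (i, j) := mem_badPartners.2 ⟨hy, fun h => hx h.2⟩
    simp [h0'] at this
  have ha : 1 ≤ #(fullRows r) := card_pos.2 ⟨i, hi⟩
  have hc : 1 ≤ #(fullRows (flip r)) := card_pos.2 ⟨j, hj⟩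
  push Not at hall
  obtain ⟨u, v, huv⟩ := hall
  have hb : 1 ≤ Fintype.card α - #(fullRows r) := by
    rw [← card_compl]
    exact card_pos.2 ⟨u, mem_compl.2 fun h => huv (mem_fullRows.1 h v)⟩
  have hd : 1 ≤ Fintype.card β - #(fullRows (flip r)) := by
    rw [← card_compl]
    exact card_pos.2 ⟨v, mem_compl.2 fun h => huv (mem_fullRows_flip.1 h u)⟩
  have hzw := sum_nonDegree_add_card_innerEdges (r := r)
  have hzb := card_compl_fullRows_le_sum_nonDegree (r := r)
  have hzd := card_compl_fullRows_le_sum_nonDegree (r := flip r)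
  rw [sum_nonDegree_flip] at hzd
  have hE := card_relEdges_eq (r := r)
  have hD := le_badCount_of_full (r := r)
  have hα := card_fullRows_le r
  have hβ := card_fullRows_le (flip r)
  generalize hA : #(fullRows r) = a at *
  generalize hC : #(fullRows (flip r)) = c at *
  generalize ∑ x, nonDegree r x = z at *
  generalize #(innerEdges r) = w at *
  obtain ⟨b, hb'⟩ := Nat.exists_eq_add_of_le hα
  obtain ⟨d, hd'⟩ := Nat.exists_eq_add_of_le hβ
  rw [hb', Nat.add_sub_cancel_left] at hb hzb
  rw [hd', Nat.add_sub_cancel_left] at hd hzd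
  rw [hb', hd', Nat.add_sub_cancel_left] at hE
  rw [hb', hd', Nat.add_sub_cancel_left, Nat.add_sub_cancel_left] at hzw
  by_cases hfam : (d = 1 ∧ (a = 1 ∨ b = 1)) ∨ (b = 1 ∧ (c = 1 ∨ d = 1))
  · refine Or.inr (Or.inr ⟨a, b, c, d, ha, hb, hc, hd, ?_, ?_, hfam⟩)
    · refine ⟨fullRows r, fullRows (flip r), hA, hb', hC, hd', ?_⟩
      rcases hfam with h | h
      · exact rel_iff_of_card_eq_one (by rw [hC, hd', h.1]; omega)
      · intro x y
        rw [or_comm]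
        exact rel_iff_of_card_eq_one (r := flip r)
          (by rw [show flip (flip r) = r from rfl, hA, hb', h.1]; omega) y x
    -- With b = 1 or d = 1 the inner block is a single line, and each of its cells is forced to be a
    -- non-edge.
    · have : z = b * d := by
        rcases hfam with h | h <;> rw [h.1] at hzw ⊢ <;> first | rw [h.1] at hzd | rw [h.1] at hzb
        all_goals omega
      have hw : w = 0 := by omega
      rw [this, hw] at hD
      linarith
  · left
    rcases block_arith ha hb hc hd hzw hzb hzd with h | h
    · have hE' : #(relEdges r) = a * c + a * d + b * c + w := by rw [hE]; ring
      refine ⟨by linarith, ?_⟩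
      have h1 : 1 ≤ a * c := Nat.mul_pos ha hc
      have h2 : 1 ≤ a * d := Nat.mul_pos ha hd
      have h3 : 1 ≤ b * c := Nat.mul_pos hb hc
      -- Fewer than four edges would force a = d = 1, an exceptional family.
      by_contra! hlt
      have h4 : a * d = 1 := by omega
      rw [mul_eq_one] at h4
      exact hfam (Or.inl ⟨h4.2, Or.inl h4.1⟩)
    · exact absurd h hfam

end Full

/-! ### Eigenvalue bounds -/

section Spectral

open Finset

theorem hasEigenvalue_adjMatrix_iff {V : Type*} [Fintype V] (G : SimpleGraph V)
    [DecidableRel G.Adj] (μ : ℝ) :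
    Module.End.HasEigenvalue (G.adjMatrix ℝ).mulVecLin μ ↔
      ∃ v : V → ℝ, v ≠ 0 ∧ ∀ u, ∑ w, (if G.Adj u w then v w else 0) = μ * v u := by
  constructor
  · intro h
    obtain ⟨v, hv⟩ := h.exists_hasEigenvector
    refine ⟨v, hv.2, fun u => ?_⟩
    have := congrFun hv.apply_eq_smul u
    simpa [Matrix.mulVec, dotProduct, SimpleGraph.adjMatrix_apply] using this
  · rintro ⟨v, hv, h⟩
    refine Module.End.hasEigenvalue_of_hasEigenvector (x := v)
      ⟨Module.End.mem_eigenspace_iff.2 (funext fun u => ?_), hv⟩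
    simpa [Matrix.mulVec, dotProduct, SimpleGraph.adjMatrix_apply] using h u

theorem finite_setOf_hasEigenvalue {V : Type*} [Fintype V] (f : Module.End ℝ (V → ℝ)) :
    {μ : ℝ | f.HasEigenvalue μ}.Finite := by
  refine (f.finite_spectrum).subset fun μ hμ => ?_
  exact Module.End.HasEigenvalue.mem_spectrum hμ

theorem SimpleGraph.Iso.adjSpectralRadius_eq {V W : Type*} [Fintype V] [Fintype W]
    {G : SimpleGraph V} {H : SimpleGraph W} (φ : G ≃g H) :
    adjSpectralRadius G = adjSpectralRadius H := by
  classical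
  unfold adjSpectralRadius
  congr 1
  ext μ
  rw [Set.mem_ofPred_eq, Set.mem_ofPred_eq, hasEigenvalue_adjMatrix_iff,
    hasEigenvalue_adjMatrix_iff]
  constructor
  · rintro ⟨v, hv, h⟩
    refine ⟨v ∘ φ.symm, fun h0 => hv (funext fun u => ?_), fun u => ?_⟩
    · simpa using congrFun h0 (φ u)
    · rw [Function.comp_apply, ← h (φ.symm u)]
      refine (Fintype.sum_equiv φ.toEquiv _ _ fun w => ?_).symm
      have : G.Adj (φ.symm u) w ↔ H.Adj u (φ w) := by
        rw [← φ.map_adj_iff]; simp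
      simp [this]
  · rintro ⟨v, hv, h⟩
    refine ⟨v ∘ φ, fun h0 => hv (funext fun u => ?_), fun u => ?_⟩
    · simpa using congrFun h0 (φ.symm u)
    · rw [Function.comp_apply, ← h (φ u)]
      refine Fintype.sum_equiv φ.toEquiv _ _ fun w => ?_
      simp [φ.map_adj_iff]

theorem le_adjSpectralRadius {V : Type*} [Fintype V] {G : SimpleGraph V} {μ : ℝ}
    {v : V → ℝ} (hv : v ≠ 0)
    (h : ∀ u, (open Classical in ∑ w, (if G.Adj u w then v w else 0)) = μ * v u) :
    μ ≤ adjSpectralRadius G := by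
  classical
  refine le_csSup (finite_setOf_hasEigenvalue _).bddAbove ?_
  rw [Set.mem_ofPred_eq, hasEigenvalue_adjMatrix_iff]
  exact ⟨v, hv, h⟩

theorem adjSpectralRadius_lt {V : Type*} [Fintype V] {G : SimpleGraph V} {c : ℝ} (hc : 0 < c)
    (h : ∀ μ : ℝ, ∀ v : V → ℝ, v ≠ 0 →
      (∀ u, (open Classical in ∑ w, (if G.Adj u w then v w else 0)) = μ * v u) → μ < c) :
    adjSpectralRadius G < c := by
  classical
  unfold adjSpectralRadius
  rcases Set.eq_empty_or_nonempty
    {μ : ℝ | Module.End.HasEigenvalue (G.adjMatrix ℝ).mulVecLin μ} with h0 | h0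
  -- Without eigenvalues, as for an empty vertex set, the supremum defaults to 0.
  · rw [h0, Real.sSup_empty]
    exact hc
  · have := h0.csSup_mem (finite_setOf_hasEigenvalue _)
    rw [Set.mem_ofPred_eq, hasEigenvalue_adjMatrix_iff] at this
    obtain ⟨v, hv, hv'⟩ := this
    exact h _ v hv hv'

variable {α β : Type*} [Fintype α] [Fintype β] {r : α → β → Prop}

open Classical in
theorem sum_bipartiteOfRel_inl (x : α → ℝ) (y : β → ℝ) (i : α) :
    ∑ w, (if (bipartiteOfRel r).Adj (Sum.inl i) w then Sum.elim x y w else 0) =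
      ∑ j, if r i j then y j else 0 := by
  have h1 : ∀ k, ¬ (bipartiteOfRel r).Adj (Sum.inl i) (Sum.inl k) := fun k h => h
  have h2 : ∀ j, (bipartiteOfRel r).Adj (Sum.inl i) (Sum.inr j) ↔ r i j := fun j => Iff.rfl
  simp [h1, h2]

open Classical in
theorem sum_bipartiteOfRel_inr (x : α → ℝ) (y : β → ℝ) (j : β) :
    ∑ w, (if (bipartiteOfRel r).Adj (Sum.inr j) w then Sum.elim x y w else 0) =
      ∑ i, if r i j then x i else 0 := by
  have h1 : ∀ k, ¬ (bipartiteOfRel r).Adj (Sum.inr j) (Sum.inr k) := fun k h => h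
  have h2 : ∀ i, (bipartiteOfRel r).Adj (Sum.inr j) (Sum.inl i) ↔ r i j := fun i => Iff.rfl
  simp [h1, h2]

/-- On vectors constant on C and on its complement, Bᵀ B acts as a 2 × 2 matrix with trace ac + ad +
bc and determinant abcd, so `hroot` is its characteristic equation. -/
theorem IsBlock.sqrt_le_adjSpectralRadius {a b c d : ℕ} (h : IsBlock r a b c d) (ha : 1 ≤ a)
    (hc : 1 ≤ c) (hd : 1 ≤ d) {l : ℝ} (hl : 0 < l)
    (hroot : l * ((a * c + a * d + b * c : ℕ) - l) = (a * b * c * d : ℕ)) :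
    √l ≤ adjSpectralRadius (bipartiteOfRel r) := by
  classical
  obtain ⟨A, C, hA, hα, hC, hβ, hr⟩ := h
  have hbA : #Aᶜ = b := by rw [card_compl, hA, hα]; omega
  have hdC : #Cᶜ = d := by rw [card_compl, hC, hβ]; omega
  set ρ := √l with hρ
  have hρ2 : ρ * ρ = l := Real.mul_self_sqrt hl.le
  have hρ0 : 0 < ρ := Real.sqrt_pos.2 hl
  -- The equation at columns outside C fixes the ratio (l - ad) : ac for y; x is B y / ρ. The
  -- equation at columns in C is then `hroot`.
  let x : α → ℝ := fun i => if i ∈ A then (c * (l - a * d) + d * (a * c)) / ρ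
    else c * (l - a * d) / ρ
  let y : β → ℝ := fun j => if j ∈ C then l - a * d else a * c
  have hx : ∀ i, (∑ j, if r i j then y j else 0) = ρ * x i := by
    intro i
    rw [← sum_add_sum_compl C]
    have h1 : (∑ j ∈ C, if r i j then y j else 0) = c * (l - a * d) := by
      rw [sum_congr rfl (g := fun _ => (l - a * d : ℝ)) fun j hj => by simp [hr, y, hj]]
      rw [sum_const, hC, nsmul_eq_mul]
    have h2 : (∑ j ∈ Cᶜ, if r i j then y j else 0) = if i ∈ A then (d * (a * c) : ℝ) else 0 := by
      rw [sum_congr rfl (g := fun _ => if i ∈ A then (a * c : ℝ) else 0) fun j hj => by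
        simp [hr, y, mem_compl.1 hj]]
      simp [hdC]
    rw [h1, h2]
    have hcan : ∀ u : ℝ, ρ * (u / ρ) = u := fun u => mul_div_cancel₀ u hρ0.ne'
    by_cases hi : i ∈ A <;> simp [x, hi, hcan]
  have hy : ∀ j, (∑ i, if r i j then x i else 0) = ρ * y j := by
    intro j
    rw [← sum_add_sum_compl A]
    have h1 : (∑ i ∈ A, if r i j then x i else 0) =
        a * ((c * (l - a * d) + d * (a * c)) / ρ) := by
      rw [sum_congr rfl (g := fun _ => ((c * (l - a * d) + d * (a * c)) / ρ : ℝ)) fun j hj => by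
        simp [hr, x, hj]]
      simp [hA]
    have h2 : (∑ i ∈ Aᶜ, if r i j then x i else 0) =
        if j ∈ C then (b * (c * (l - a * d) / ρ) : ℝ) else 0 := by
      rw [sum_congr rfl (g := fun _ => if j ∈ C then (c * (l - a * d) / ρ : ℝ) else 0)
        fun j hj => by simp [hr, x, mem_compl.1 hj]]
      simp [hbA]
    rw [h1, h2]
    push_cast at hroot
    by_cases hj : j ∈ C <;> simp only [y, hj, if_true, if_false] <;> field_simp <;>
      rw [pow_two, hρ2] <;> linarith
  refine le_adjSpectralRadius (v := Sum.elim x y) ?_ ?_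
  · intro h0
    have : Cᶜ.Nonempty := card_pos.1 (by omega)
    obtain ⟨j, hj⟩ := this
    have := congrFun h0 (Sum.inr j)
    simp only [Sum.elim_inr, y, mem_compl.1 hj, if_false, Pi.zero_apply] at this
    have h1 : (0 : ℝ) < a := by exact_mod_cast ha
    have h2 : (0 : ℝ) < c := by exact_mod_cast hc
    exact (mul_pos h1 h2).ne' this
  · rintro (i | j)
    · exact (sum_bipartiteOfRel_inl x y i).trans (hx i)
    · exact (sum_bipartiteOfRel_inr x y j).trans (hy j)

open Classical in
/-- The squared Frobenius norm of `B Bᵀ`, for the biadjacency matrix `B` of `r`. -/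
theorem sum_codegree_sq (r : α → β → Prop) :
    ∑ i, ∑ k, (∑ j, (if r i j ∧ r k j then (1 : ℝ) else 0)) ^ 2 + badCount r =
      (#(relEdges r) : ℝ) ^ 2 := by
  have h1 : ∀ p ∈ relEdges r, (#(badPartners r p) : ℝ) +
      #((relEdges r).filter fun q => r p.1 q.2 ∧ r q.1 p.2) = #(relEdges r) := by
    intro p _
    rw [← card_filter_add_card_filter_not (s := relEdges r) fun q => r p.1 q.2 ∧ r q.1 p.2]
    rw [badPartners]
    push_cast
    rw [add_comm]
  have h2 := sum_congr rfl h1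
  rw [sum_add_distrib, sum_const, nsmul_eq_mul, ← pow_two] at h2
  rw [← h2, add_comm, badCount]
  push_cast
  congr 1
  simp only [card_filter, relEdges, sum_filter, Fintype.sum_prod_type]
  push_cast
  refine sum_congr rfl fun i _ => ?_
  -- For rows i, k, the square of the codegree counts column pairs (j, l) with all four incidences,
  -- that is, edges (i, j), (k, l) that do not form a bad pair.
  have h3 : ∀ j, (if r i j then ∑ k, ∑ l, (if r k l then
      (if r i l ∧ r k j then (1 : ℝ) else 0) else 0) else 0) =
      ∑ k, ∑ l, (if r i j ∧ r k j then (1 : ℝ) else 0) * (if r i l ∧ r k l then 1 else 0) := by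
    intro j
    split_ifs with hij
    · refine sum_congr rfl fun k _ => sum_congr rfl fun l _ => ?_
      by_cases h1 : r k l <;> by_cases h2 : r i l <;> by_cases h3 : r k j <;> simp [*]
    · simp [hij]
  rw [sum_congr rfl fun j _ => h3 j, sum_comm]
  refine sum_congr rfl fun k _ => ?_
  rw [pow_two, sum_mul_sum]

/-- A nonzero eigenvalue of a bipartite graph is bounded by the Frobenius norm of `B Bᵀ`. -/
theorem pow_four_add_badCount_le {μ : ℝ} (hμ : μ ≠ 0) {v : α ⊕ β → ℝ} (hv : v ≠ 0)
    (h : ∀ u, (open Classical in ∑ w, (if (bipartiteOfRel r).Adj u w then v w else 0)) =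
      μ * v u) : μ ^ 4 + badCount r ≤ (#(relEdges r) : ℝ) ^ 2 := by
  classical
  obtain ⟨x, y, rfl⟩ : ∃ x y, v = Sum.elim x y :=
    ⟨v ∘ Sum.inl, v ∘ Sum.inr, (Sum.elim_comp_inl_inr v).symm⟩
  have hx : ∀ i, (∑ j, if r i j then y j else 0) = μ * x i := fun i =>
    (sum_bipartiteOfRel_inl x y i).symm.trans (h (Sum.inl i))
  have hy : ∀ j, (∑ i, if r i j then x i else 0) = μ * y j := fun j =>
    (sum_bipartiteOfRel_inr x y j).symm.trans (h (Sum.inr j))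
  set M : α → α → ℝ := fun i k => ∑ j, (if r i j ∧ r k j then (1 : ℝ) else 0) with hM
  have hMx : ∀ i, ∑ k, M i k * x k = μ ^ 2 * x i := by
    intro i
    simp only [hM, sum_mul]
    rw [sum_comm, pow_two, mul_assoc, ← hx i, mul_sum]
    refine sum_congr rfl fun j _ => ?_
    by_cases hij : r i j
    · simp only [hij, true_and, if_true, ← hy j]
      exact sum_congr rfl fun k _ => by split_ifs <;> simp
    · simp [hij]
  have hpos : 0 < ∑ i, x i ^ 2 := by
    refine (sum_nonneg fun i _ => sq_nonneg (x i)).lt_of_ne' fun h0 => hv ?_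
    rw [sum_eq_zero_iff_of_nonneg fun i _ => sq_nonneg (x i)] at h0
    have hx0 : ∀ i, x i = 0 := fun i => by simpa using h0 i (mem_univ i)
    have hy0 : ∀ j, y j = 0 := fun j => by
      have := hy j
      simp only [hx0, ite_self, sum_const_zero] at this
      exact (mul_eq_zero.1 this.symm).resolve_left hμ
    funext u
    rcases u with i | j
    · exact hx0 i
    · exact hy0 j
  -- Cauchy–Schwarz in each row of M = B Bᵀ, for which x is an eigenvector with eigenvalue μ².
  have key : μ ^ 4 * ∑ i, x i ^ 2 ≤ (∑ i, ∑ k, M i k ^ 2) * ∑ i, x i ^ 2 := by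
    rw [mul_sum, sum_mul]
    refine sum_le_sum fun i _ => ?_
    have := sum_mul_sq_le_sq_mul_sq univ (M i) x
    rw [hMx i] at this
    calc μ ^ 4 * x i ^ 2 = (μ ^ 2 * x i) ^ 2 := by ring
      _ ≤ _ := this
  have := le_of_mul_le_mul_right key hpos
  linarith [sum_codegree_sq r]

/-- Comparison with a block graph with the same number `e` of edges. -/
theorem IsBlock.adjSpectralRadius_lt {γ δ : Type*} [Fintype γ] [Fintype δ] {r' : γ → δ → Prop}
    {a b c d : ℕ} (h : IsBlock r' a b c d) (ha : 1 ≤ a) (hc : 1 ≤ c) (hd : 1 ≤ d)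
    (he : #(relEdges r) = a * c + a * d + b * c)
    (hN : a * b * c * d + 2 ≤ #(relEdges r)) (hD : 2 * (a * b * c * d) + 1 ≤ badCount r) :
    adjSpectralRadius (bipartiteOfRel r) < adjSpectralRadius (bipartiteOfRel r') := by
  obtain ⟨N, hN'⟩ : ∃ N, N = a * b * c * d := ⟨_, rfl⟩
  have hlow := fun l : ℝ => h.sqrt_le_adjSpectralRadius ha hc hd (l := l)
  rw [← he, ← hN'] at hlow
  rw [← hN'] at hN hD
  generalize hcard : #(relEdges r) = e at *
  have hNR : (N : ℝ) + 2 ≤ e := by exact_mod_cast hN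
  have hDR : 2 * (N : ℝ) + 1 ≤ badCount r := by exact_mod_cast hD
  have hN0 : (0 : ℝ) ≤ N := N.cast_nonneg
  have hdisc : 0 ≤ (e : ℝ) ^ 2 - 4 * N := by nlinarith [sq_nonneg ((e : ℝ) - 2)]
  -- The larger root of l(e - l) = N.
  set l : ℝ := (e + √((e : ℝ) ^ 2 - 4 * N)) / 2 with hl
  have hsq := Real.sq_sqrt hdisc
  have hs0 := Real.sqrt_nonneg ((e : ℝ) ^ 2 - 4 * N)
  have hle : (e : ℝ) / 2 ≤ l := by rw [hl]; linarith
  have hroot : l * (e - l) = N := by rw [hl]; linarith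
  have hlpos : 0 < l := by linarith
  refine lt_of_lt_of_le ?_ (hlow l hlpos hroot)
  refine _root_.adjSpectralRadius_lt (Real.sqrt_pos.2 hlpos) fun μ v hv hμv => ?_
  by_contra! hcon
  have hμ0 : 0 < μ := (Real.sqrt_pos.2 hlpos).trans_le hcon
  have hup := pow_four_add_badCount_le hμ0.ne' hv hμv
  have hm : l ≤ μ ^ 2 := by
    rw [← Real.sq_sqrt hlpos.le]
    exact pow_le_pow_left₀ (Real.sqrt_nonneg l) hcon 2
  rw [show μ ^ 4 = (μ ^ 2) ^ 2 by ring, hcard] at hup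
  generalize μ ^ 2 = m at hm hup
  have h1 : m * (e - m) ≤ N := by 
    nlinarith [mul_nonneg (sub_nonneg.2 hm) (by linarith : 0 ≤ m + l - e)]
  -- On [1, e - 1] the product m(e - m) is at least e - 1, which exceeds N.
  have h2 : (e : ℝ) - 1 < m := by
    by_contra! h3
    nlinarith [mul_nonneg (by linarith : 0 ≤ m - 1) (by linarith : 0 ≤ (e : ℝ) - 1 - m)]
  have h3 : m ≤ e := by
    by_contra! h3
    nlinarith
  -- (e - m)² = (e² - m²) - 2m(e - m) ≥ D - 2N ≥ 1, although 0 ≤ e - m < 1.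
  nlinarith

end Spectral

/-! ### Isomorphisms between block graphs and the named graphs -/

section Iso

open Finset

variable {α β : Type*} [Fintype α] [Fintype β] {r : α → β → Prop}

/-- Bijections preserving the relation induce an isomorphism. -/
def bipartiteOfRelCongr {α β γ δ : Type*} {r : α → β → Prop} {r' : γ → δ → Prop} (f : α ≃ γ)
    (g : β ≃ δ) (h : ∀ x y, r x y ↔ r' (f x) (g y)) : bipartiteOfRel r ≃g bipartiteOfRel r' where
  toEquiv := Equiv.sumCongr f g
  map_rel_iff' := by
    rintro (x | x) (y | y)
    · exact Iff.rfl
    · exact (h x y).symm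
    · exact (h y x).symm
    · exact Iff.rfl

/-- Interchanging the two sides. -/
def bipartiteOfRelSwap {α β : Type*} (r : α → β → Prop) :
    bipartiteOfRel (flip r) ≃g bipartiteOfRel r where
  toEquiv := Equiv.sumComm β α
  map_rel_iff' := by rintro (x | x) (y | y) <;> exact Iff.rfl

theorem exists_equiv_mem_iff {α γ : Type*} [Fintype α] [Fintype γ] {A : Finset α} {A' : Finset γ}
    (hA : #A = #A') (h : Fintype.card α = Fintype.card γ) :
    ∃ f : α ≃ γ, ∀ x, x ∈ A ↔ f x ∈ A' := by
  classical
  have e1 : {x // x ∈ A} ≃ {x // x ∈ A'} := Fintype.equivOfCardEq (by simpa using hA)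
  have e2 : {x // x ∉ A} ≃ {x // x ∉ A'} := Fintype.equivOfCardEq (by
    rw [Fintype.card_subtype_compl, Fintype.card_subtype_compl, h]; simp [hA])
  refine ⟨(Equiv.sumCompl (· ∈ A)).symm.trans ((e1.sumCongr e2).trans (Equiv.sumCompl (· ∈ A'))),
    fun x => ?_⟩
  by_cases hx : x ∈ A
  · simp [Equiv.sumCompl_symm_apply_of_pos hx, hx]
  · simp only [hx, false_iff]
    simpa [Equiv.sumCompl_symm_apply_of_neg hx] using (e2 ⟨x, hx⟩).2

theorem IsBlock.nonempty_iso {γ δ : Type*} [Fintype γ] [Fintype δ] {r' : γ → δ → Prop}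
    {a b c d : ℕ} (h : IsBlock r a b c d) (h' : IsBlock r' a b c d) :
    Nonempty (bipartiteOfRel r ≃g bipartiteOfRel r') := by
  obtain ⟨A, C, h1, h2, h3, h4, h5⟩ := h
  obtain ⟨A', C', h1', h2', h3', h4', h5'⟩ := h'
  obtain ⟨f, hf⟩ := exists_equiv_mem_iff (h1.trans h1'.symm) (h2.trans h2'.symm)
  obtain ⟨g, hg⟩ := exists_equiv_mem_iff (h3.trans h3'.symm) (h4.trans h4'.symm)
  exact ⟨bipartiteOfRelCongr f g fun x y => by rw [h5, h5', hf, hg]⟩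

theorem isBlock_completeBipartiteMinus (a c : ℕ) :
    IsBlock (fun (i : Fin (a + 1)) (j : Fin (c + 1)) => ¬ (i.val = 0 ∧ j.val = 0)) a 1 c 1 := by
  have h : ∀ n : ℕ, #({0}ᶜ : Finset (Fin (n + 1))) = n := fun n => by
    rw [card_compl, Fintype.card_fin, card_singleton, Nat.add_sub_cancel]
  refine ⟨{0}ᶜ, {0}ᶜ, h a, Fintype.card_fin _, h c, Fintype.card_fin _, fun x y => ?_⟩
  rw [mem_compl, mem_compl, mem_singleton, mem_singleton, Fin.ext_iff, Fin.ext_iff, Fin.val_zero,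
    Fin.val_zero]
  tauto

/-- The full row is the neighbour of the pendant vertex, and the one non-full column is the pendant
vertex itself. -/
theorem isBlock_completeBipartitePlus (b c : ℕ) :
    IsBlock (fun (i : Fin (b + 1)) (j : Fin (c + 1)) => j.val < c ∨ i.val = 0) 1 b c 1 := by
  refine ⟨{0}, {Fin.last c}ᶜ, card_singleton _, by rw [Fintype.card_fin, add_comm], ?_,
    Fintype.card_fin _, fun x y => ?_⟩
  · rw [card_compl, Fintype.card_fin, card_singleton, Nat.add_sub_cancel]
  · rw [mem_compl, mem_singleton, mem_singleton, Fin.ext_iff, Fin.ext_iff, Fin.val_zero,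
      Fin.val_last]
    have := y.isLt
    constructor <;> rintro (h | h) <;> omega

theorem nonempty_iso_completeBipartiteGraph {p q : ℕ} (hp : Fintype.card α = p)
    (hq : Fintype.card β = q) (h : ∀ x y, r x y) :
    Nonempty (bipartiteOfRel r ≃g completeBipartiteGraph (Fin p) (Fin q)) := by
  refine ⟨⟨Equiv.sumCongr (Fintype.equivFinOfCardEq hp) (Fintype.equivFinOfCardEq hq), ?_⟩⟩
  rintro (x | x) (y | y) <;> simp [completeBipartiteGraph, bipartiteOfRel, h]

theorem card_relEdges_eq_ncard (r : α → β → Prop) :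
    (bipartiteOfRel r).edgeSet.ncard = #(relEdges r) := by
  rw [← Set.ncard_coe_finset]
  symm
  refine Set.ncard_congr (fun p _ => s(Sum.inl p.1, Sum.inr p.2)) ?_ ?_ ?_
  · rintro ⟨x, y⟩ h
    exact mem_relEdges.1 h
  · rintro ⟨x, y⟩ ⟨x', y'⟩ _ _ h
    simpa using h
  · intro e
    induction e with
    | _ u v =>
      rcases u with x | x <;> rcases v with y | y <;> intro h
      · exact h.elim
      · exact ⟨(x, y), mem_coe.2 (mem_relEdges.2 h), rfl⟩
      · exact ⟨(y, x), mem_coe.2 (mem_relEdges.2 h), Sym2.eq_swap⟩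
      · exact h.elim

/-- A graph isomorphism preserves the number of edges. -/
theorem SimpleGraph.Iso.ncard_edgeSet_eq {V W : Type*} {G : SimpleGraph V} {H : SimpleGraph W}
    (φ : G ≃g H) : G.edgeSet.ncard = H.edgeSet.ncard := by
  rw [← Nat.card_coe_set_eq, ← Nat.card_coe_set_eq]
  exact Nat.card_congr φ.mapEdgeSet

theorem SimpleGraph.IsBipartite.exists_iso_bipartiteOfRel {V : Type*} [Fintype V]
    {G : SimpleGraph V} (h : G.IsBipartite) : ∃ p : V → Prop,
      (∀ u v, G.Adj u v → (p u ↔ ¬ p v)) ∧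
      Nonempty (bipartiteOfRel (fun (x : {v // p v}) (y : {v // ¬ p v}) => G.Adj x y) ≃g G) := by
  classical
  obtain ⟨c⟩ := h
  have hc : ∀ u v, G.Adj u v → (c u = 0 ↔ ¬ c v = 0) := fun u v h => by
    have := c.valid h
    omega
  refine ⟨fun v => c v = 0, hc, ⟨⟨Equiv.sumCompl _, ?_⟩⟩⟩
  rintro (⟨x, hx⟩ | ⟨x, hx⟩) (⟨y, hy⟩ | ⟨y, hy⟩)
  · simp only [Equiv.sumCompl_apply_inl]
    exact ⟨fun h => (hc x y h).1 hx hy, False.elim⟩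
  · exact Iff.rfl
  · exact G.adj_comm x y
  · simp only [Equiv.sumCompl_apply_inr]
    exact ⟨fun h => hx ((hc x y h).2 hy), False.elim⟩

end Iso

/-! ### Comparison of bad counts and the theorem -/

section Main

open Finset

variable {α β : Type*} [Fintype α] [Fintype β] {r : α → β → Prop}

/-- The number of bad pairs of `r` exceeds those of `K⁺_{s,t}` and `K⁻_{s,t}`, if these have
as many edges. -/
def ExceedsNearlyComplete (r : α → β → Prop) (s t : ℕ) : Prop :=
  (#(relEdges r) = (s + 2) * (t + 2) + 1 → 2 * ((s + 1) * (t + 2)) + 1 ≤ badCount r) ∧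
  (#(relEdges r) + 1 = (s + 2) * (t + 2) → 2 * ((s + 1) * (t + 1)) + 1 ≤ badCount r)

/-- Here the graph is a complete bipartite graph with parts b + 1 > c and a pendant edge at the
larger part. For a fixed number of edges, bc grows as c shrinks, so an upper bound on c suffices. -/
theorem exceedsNearlyComplete_of_isBlock {b c s t : ℕ} (h : IsBlock r 1 b c 1) (hb : 2 ≤ b)
    (hc : 1 ≤ c) (hcb : c ≤ b) (hst : s ≤ t) (hD : 2 * (b * c) ≤ badCount r) :
    ExceedsNearlyComplete r s t := by
  unfold ExceedsNearlyComplete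
  rw [h.card_relEdges]
  refine ⟨fun he => ?_, fun he => ?_⟩
  · have h1 : c < t + 2 := by
      by_contra! h1
      nlinarith
    nlinarith
  · suffices c < s + t + 1 by nlinarith
    by_contra! h1
    obtain ⟨k, rfl⟩ := Nat.exists_eq_add_of_le hst
    obtain ⟨m, rfl⟩ := Nat.exists_eq_add_of_le h1
    obtain ⟨n, rfl⟩ := Nat.exists_eq_add_of_le hcb
    -- The estimate from c ≤ b and s + t + 1 ≤ c is tight only for s = t = 0, where 2 ≤ b gives the
    -- contradiction.
    rcases Nat.eq_zero_or_pos s with rfl | hs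
    · nlinarith
    · nlinarith

theorem ExceedsNearlyComplete.of_flip {s t : ℕ} (h : ExceedsNearlyComplete (flip r) s t) :
    ExceedsNearlyComplete r s t := by
  unfold ExceedsNearlyComplete at *
  rwa [card_relEdges_flip, badCount_flip] at h

theorem exceedsNearlyComplete {s t : ℕ} (hst : s ≤ t) (hrow : ∀ a, ∃ b, r a b)
    (hcol : ∀ b, ∃ a, r a b) (h0 : 1 ≤ #(relEdges r))
    (hK : ∀ p q : ℕ, 1 ≤ p → p ≤ q → #(relEdges r) = p * q →
      ¬ Nonempty (bipartiteOfRel r ≃g completeBipartiteGraph (Fin p) (Fin q)))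
    (hKminus : ∀ p q : ℕ, 2 ≤ p → p ≤ q → #(relEdges r) + 1 = p * q →
      ¬ Nonempty (bipartiteOfRel r ≃g completeBipartiteMinus p q))
    (hKplus : ∀ p q : ℕ, 2 ≤ p → p ≤ q → #(relEdges r) = p * q + 1 →
      ¬ Nonempty (bipartiteOfRel r ≃g completeBipartitePlus p q)) :
    ExceedsNearlyComplete r s t := by
  rcases le_badCount_or_isBlock hrow hcol with h | ⟨h, h4⟩ | h |
    ⟨a, b, c, d, ha, hb, hc, hd, h, hD, hfam⟩
  · constructor <;> intro he <;> nlinarith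
  · constructor
    · intro he; nlinarith
    · intro he
      -- For s = t = 0, the comparison with K⁻ with both parts of order 2, there would be only three
      -- edges, and the bound 2e - 4 would be too weak.
      have : 1 ≤ s + t := by
        by_contra! hlt
        obtain ⟨rfl, rfl⟩ : s = 0 ∧ t = 0 := by omega
        omega
      nlinarith
  · have hcard : #(relEdges r) = Fintype.card α * Fintype.card β := by
      classical
      rw [← Fintype.card_prod, ← card_univ]
      congr 1
      ext p
      simp [mem_relEdges, h]
    have hpos : 0 < Fintype.card α * Fintype.card β := by omega
    rcases le_total (Fintype.card α) (Fintype.card β) with hle | hle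
    · exact absurd (nonempty_iso_completeBipartiteGraph rfl rfl h)
        (hK _ _ (Nat.pos_of_mul_pos_right hpos) hle hcard)
    · obtain ⟨φ⟩ := nonempty_iso_completeBipartiteGraph (r := flip r) rfl rfl fun x y => h y x
      exact absurd ⟨(bipartiteOfRelSwap r).symm.trans φ⟩
        (hK _ _ (Nat.pos_of_mul_pos_left hpos) hle (hcard.trans (mul_comm _ _)))
  · have hcard := h.card_relEdges
    by_cases hbd : b = 1 ∧ d = 1
    · obtain ⟨rfl, rfl⟩ := hbd
      exfalso
      rcases le_total a c with hle | hle
      · exact hKminus (a + 1) (c + 1) (by omega) (by omega) (by rw [hcard]; ring)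
          (h.nonempty_iso (isBlock_completeBipartiteMinus a c))
      · obtain ⟨φ⟩ := h.flip.nonempty_iso (isBlock_completeBipartiteMinus c a)
        exact hKminus (c + 1) (a + 1) (by omega) (by omega) (by rw [hcard]; ring)
          ⟨(bipartiteOfRelSwap r).symm.trans φ⟩
    · have hfam' : (a = 1 ∧ d = 1 ∧ 2 ≤ b) ∨ (b = 1 ∧ c = 1 ∧ 2 ≤ d) := by omega
      rcases hfam' with ⟨rfl, rfl, hb2⟩ | ⟨rfl, rfl, hd2⟩
      -- The pendant edge sits at the part of order b + 1; the graph is an excluded K⁺ exactly when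
      -- that part is not the larger one.
      · rcases Nat.lt_or_ge b c with hlt | hge
        · exact absurd (h.nonempty_iso (isBlock_completeBipartitePlus b c))
            (hKplus (b + 1) c (by omega) hlt (by rw [hcard]; ring))
        · exact exceedsNearlyComplete_of_isBlock h hb2 hc hge hst (by linarith)
      · rcases Nat.lt_or_ge d a with hlt | hge
        · obtain ⟨φ⟩ := h.flip.nonempty_iso (isBlock_completeBipartitePlus d a)
          exact absurd ⟨(bipartiteOfRelSwap r).symm.trans φ⟩
            (hKplus (d + 1) a (by omega) hlt (by rw [hcard]; ring))
        · exact (exceedsNearlyComplete_of_isBlock h.flip hd2 ha hge hst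
            (by rw [badCount_flip]; linarith)).of_flip

end Main

theorem corollary4p4 {V : Type*} [Fintype V] (G : SimpleGraph V) (e : ℕ)
    (he : G.edgeSet.ncard = e)
    (hbip : G.IsBipartite)
    (hiso : ∀ v : V, ¬ G.IsIsolated v)
    (hK : ∀ p q : ℕ, 1 ≤ p → p ≤ q → e = p * q →
      ¬ Nonempty (G ≃g completeBipartiteGraph (Fin p) (Fin q)))
    (hKminus : ∀ p q : ℕ, 2 ≤ p → p ≤ q → e + 1 = p * q →
      ¬ Nonempty (G ≃g completeBipartiteMinus p q))
    (hKplus : ∀ p q : ℕ, 2 ≤ p → p ≤ q → e = p * q + 1 →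
      ¬ Nonempty (G ≃g completeBipartitePlus p q))
    (s t : ℕ) (hs : 2 ≤ s) (hst : s ≤ t) :
    (e = s * t + 1 → adjSpectralRadius G < adjSpectralRadius (completeBipartitePlus s t)) ∧
    (e + 1 = s * t → adjSpectralRadius G < adjSpectralRadius (completeBipartiteMinus s t)) := by
  classical
  obtain ⟨p, hp, ⟨φ⟩⟩ := hbip.exists_iso_bipartiteOfRel
  have hnbr : ∀ v, ∃ w, G.Adj v w := fun v => by
    simpa [SimpleGraph.IsIsolated] using hiso v
  have hrow : ∀ x : {v // p v}, ∃ y : {v // ¬ p v}, G.Adj x y := fun x => by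
    obtain ⟨w, hw⟩ := hnbr x
    exact ⟨⟨w, (hp _ _ hw).1 x.2⟩, hw⟩
  have hcol : ∀ y : {v // ¬ p v}, ∃ x : {v // p v}, G.Adj x y := fun y => by
    obtain ⟨w, hw⟩ := hnbr y
    exact ⟨⟨w, (hp _ _ hw.symm).2 y.2⟩, hw.symm⟩
  set r := fun (x : {v // p v}) (y : {v // ¬ p v}) => G.Adj x y
  have hcard : (relEdges r).card = e := by
    rw [← card_relEdges_eq_ncard, φ.ncard_edgeSet_eq, he]
  obtain ⟨s, rfl⟩ := Nat.exists_eq_add_of_le' hs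
  obtain ⟨t, rfl⟩ := Nat.exists_eq_add_of_le' (hs.trans hst)
  rw [← φ.adjSpectralRadius_eq]
  by_cases h0 : e = 0
  · constructor <;> intro h <;> nlinarith
  have key : ExceedsNearlyComplete r s t := by
    refine exceedsNearlyComplete (by omega) hrow hcol (by omega) ?_ ?_ ?_ <;> rw [hcard] <;>
      rintro a b h1 h2 h3 ⟨ψ⟩
    · exact hK a b h1 h2 h3 ⟨φ.symm.trans ψ⟩
    · exact hKminus a b h1 h2 h3 ⟨φ.symm.trans ψ⟩
    · exact hKplus a b h1 h2 h3 ⟨φ.symm.trans ψ⟩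
  refine ⟨fun h => ?_, fun h => ?_⟩
  · refine (isBlock_completeBipartitePlus (s + 1) (t + 2)).adjSpectralRadius_lt le_rfl (by omega)
      le_rfl ?_ ?_ ?_
    · rw [hcard, h]; ring
    · rw [hcard, h]; nlinarith
    · have := key.1 (hcard.trans h); linarith
  · refine (isBlock_completeBipartiteMinus (s + 1) (t + 1)).adjSpectralRadius_lt (by omega)
      (by omega) le_rfl ?_ ?_ ?_
    · rw [hcard]; linarith
    · rw [hcard]; nlinarith
    · have := key.2 (by rw [hcard, h]); linarith
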